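/- Let $a,b\in(0,1]$ and consider $$K=\begin{bmatrix}1-a & a\\ b& 1-b\end{bmatrix},\qquad \pi=\frac1{a+b}\begin{bmatrix}b\\a\end{bmatrix}.$$ Then $(K,\pi)$ is an irreducible Markov chain with positive stationary distribution, i.e. $K$ is an irreducible nonnegative matrix with $K\mathbf 1=\mathbf 1$, and $\pi$ is a positive probability vector with $\pi^TK=\pi^T$. For $x,y\in\mathbb R^2$ let $\langle x,y\rangle_\pi=\sum_i\pi_ix_iy_i$, $\|x\|_{\pi,2}^2=\sum_i\pi_i|x_i|^2$, $\mathcal D(x,y)=\langle x,(I-K)y\rangle_\pi$ and, for $x\neq 0$, $\mathcal E(x)=\sum_i|x_i|^2\ln\big(|x_i|^2/\|x\|_{\pi,2}^2\big)\pi_i$. Let $$\sigma=\sup\{s\ge 0 : s\,\mathcal E(x)\le \mathcal D(x,x)\ \text{ for all } x\in\mathbb R^2 \text{ with positive entries}\}$$ be the log-Sobolev constant of $(K,\pi)$. Then this supremum is finite and $$\sqrt{ab}\ \le\ \sigma=\begin{cases}\dfrac{a-b}{\ln a-\ln b} & \text{if } a\ne b,\\[2mm] a & \text{if } a=b.\end{cases}$$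 -/

import Mathlib

namespace MarkovLS

open Matrix

/-- `(K, π)` is a finite Markov chain with positive stationary distribution `π`: `K` is an
entrywise nonnegative matrix with `K 1 = 1`, and `π` is an entrywise positive probability vector
with `πᵀ K = πᵀ`. -/
structure IsMarkovChain {n : ℕ} (K : Matrix (Fin n) (Fin n) ℝ) (π : Fin n → ℝ) : Prop where
  nonneg : ∀ i j, 0 ≤ K i j
  mulVec_one : K *ᵥ 1 = 1
  vecMul_eq : π ᵥ* K = π
  pos : ∀ i, 0 < π i
  sum_eq_one : ∑ i, π i = 1

/-- The weighted inner product `⟨x, y⟩_π = ∑ i, π i * x i * y i`. -/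
noncomputable def innerW {n : ℕ} (π x y : Fin n → ℝ) : ℝ :=
  (Matrix.diagonal π *ᵥ x) ⬝ᵥ y

/-- The weighted `ℓ^p` norm `(∑ i, π i * |x i| ^ p) ^ (1 / p)`. -/
noncomputable def normW {n : ℕ} (π : Fin n → ℝ) (p : ℝ) (x : Fin n → ℝ) : ℝ :=
  (∑ i, π i * |x i| ^ p) ^ (1 / p)

/-- The Dirichlet form `D(x, y) = ⟨x, (I - K) y⟩_π`. -/
noncomputable def dirichlet {n : ℕ} (K : Matrix (Fin n) (Fin n) ℝ) (π x y : Fin n → ℝ) : ℝ :=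
  innerW π x ((1 - K) *ᵥ y)

/-- The entropy `E(x) = ∑ i, |x i|² log (|x i|² / ‖x‖_{π,2}²) π i`. -/
noncomputable def entropy {n : ℕ} (π x : Fin n → ℝ) : ℝ :=
  ∑ i, |x i| ^ 2 * Real.log (|x i| ^ 2 / normW π 2 x ^ 2) * π i

/-- The set of all `s ≥ 0` with `s * E(x) ≤ D(x, x)` for every entrywise positive vector `x`. -/
def logSobolevSet {n : ℕ} (K : Matrix (Fin n) (Fin n) ℝ) (π : Fin n → ℝ) : Set ℝ :=
  {s | 0 ≤ s ∧ ∀ x : Fin n → ℝ, (∀ i, 0 < x i) → s * entropy π x ≤ dirichlet K π x x}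

/-- The log-Sobolev constant of `(K, π)`. -/
noncomputable def logSobolevConst {n : ℕ} (K : Matrix (Fin n) (Fin n) ℝ) (π : Fin n → ℝ) : ℝ :=
  sSup (logSobolevSet K π)

/-- The transition matrix of the two-state chain. -/
def twoStateK (a b : ℝ) : Matrix (Fin 2) (Fin 2) ℝ :=
  !![1 - a, a; b, 1 - b]

/-- The stationary distribution of the two-state chain. -/
noncomputable def twoStatePi (a b : ℝ) : Fin 2 → ℝ :=
  (1 / (a + b)) • ![b, a]

end MarkovLS

namespace MarkovLS

open Real

/-! Write `a = M * exp (-t)`, `b = M * exp t` with `M = √(ab)`. For positive `x` the weights `π i *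
x i ^ 2` are proportional to `(exp s, exp (-s))`, and `s` ranges over all reals. Put `κ = t / sinh t
≤ 1` (`1` at `t = 0`). The inequality with constant `M / κ`, divided by `cosh s`, says `f t ≤ f s`
for the even function `f s = log (cosh s) - s * tanh s - κ / cosh s`. Its derivative is `(κ * sinh s
- s) / cosh s ^ 2`; since `sinh s / s` increases on `s > 0`, `f` falls on `[0, |t|]` and rises
afterwards (`log_cosh_sub_le`). Evenness gives equality at `s = -t`, so `M / κ` is optimal when `t ≠
0`; at `t = 0` a second-order expansion does it. Finally `M / κ` is the logarithmic mean of `a` and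
`b`, and `κ ≤ 1` gives the bound by `√(ab)`. -/

theorem mul_sinh_le_mul_sinh {x y : ℝ} (hx : 0 ≤ x) (hxy : x ≤ y) :
    y * sinh x ≤ x * sinh y := by
  rcases hx.eq_or_lt with rfl | hx
  · simp
  have hconv : ConvexOn ℝ (Set.Ici 0) sinh := by
    apply MonotoneOn.convexOn_of_deriv (convex_Ici 0) continuous_sinh.continuousOn
      differentiable_sinh.differentiableOn
    rw [Real.deriv_sinh]
    intro u hu v hv huv
    rw [interior_Ici] at hu hv
    exact cosh_le_cosh.2 (by rwa [abs_of_pos hu, abs_of_pos hv])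
  have hy : 0 < y := hx.trans_le hxy
  have h := hconv.2 (Set.mem_Ici.2 le_rfl) (Set.mem_Ici.2 hy.le)
    (sub_nonneg.2 ((div_le_one hy).2 hxy)) (div_nonneg hx.le hy.le) (sub_add_cancel 1 (x / y))
  simp only [smul_eq_mul, mul_zero, zero_add, sinh_zero, div_mul_cancel₀ _ hy.ne'] at h
  calc y * sinh x ≤ y * (x / y * sinh y) := by gcongr
    _ = x * sinh y := by field_simp

/-- The entropy of a two-point distribution is a convex function of its geometric mean; here the
distribution is proportional to `(exp s, exp (-s))` and the tangent is taken at `s = t`. -/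
theorem log_cosh_sub_le_of_nonneg {κ s t : ℝ} (ht : κ * sinh t = t)
    (ht0 : t = 0 → κ = 1) (hs : 0 ≤ s) (ht' : 0 ≤ t) :
    log (cosh t) - t * sinh t / cosh t - κ / cosh t ≤
      log (cosh s) - s * sinh s / cosh s - κ / cosh s := by
  set f : ℝ → ℝ := fun s => log (cosh s) - s * sinh s / cosh s - κ / cosh s with hf
  have hd (s : ℝ) : HasDerivAt f ((κ * sinh s - s) / cosh s ^ 2) s := by
    have h0 := (cosh_pos s).ne'
    have h1 := (Real.hasDerivAt_cosh s).log h0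
    have h2 := ((hasDerivAt_id s).mul (Real.hasDerivAt_sinh s)).div (Real.hasDerivAt_cosh s) h0
    have h3 := (hasDerivAt_const s κ).div (Real.hasDerivAt_cosh s) h0
    refine ((h1.sub h2).sub h3).congr_deriv ?_
    simp only [id, Pi.mul_apply]
    field_simp
    linear_combination (-s) * (cosh_sq s)
  have hc : Continuous f := continuous_iff_continuousAt.2 fun s => (hd s).continuousAt
  have hdiff : Differentiable ℝ f := fun s => (hd s).differentiableAt
  rcases le_total s t with hst | hst
  · have hanti : AntitoneOn f (Set.Icc 0 t) := by
      apply antitoneOn_of_deriv_nonpos (convex_Icc 0 t) hc.continuousOn hdiff.differentiableOn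
      intro u hu
      rw [interior_Icc] at hu
      rw [(hd u).deriv]
      have h1 := mul_sinh_le_mul_sinh hu.1.le hu.2.le
      have h2 : 0 < sinh t := sinh_pos_iff.2 (hu.1.trans hu.2)
      -- Multiplying by `sinh t > 0` and using `κ * sinh t = t` removes `κ`.
      have h4 : κ * sinh u - u ≤ 0 := by
        refine nonpos_of_mul_nonpos_left (?_ : (κ * sinh u - u) * sinh t ≤ 0) h2
        linear_combination h1 + sinh u * ht
      exact div_nonpos_of_nonpos_of_nonneg h4 (sq_nonneg _)
    exact hanti ⟨hs, hst⟩ ⟨ht', le_rfl⟩ hst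
  · have hmono : MonotoneOn f (Set.Ici t) := by
      apply monotoneOn_of_deriv_nonneg (convex_Ici t) hc.continuousOn hdiff.differentiableOn
      intro u hu
      rw [interior_Ici, Set.mem_Ioi] at hu
      rw [(hd u).deriv]
      have hu0 : 0 < u := ht'.trans_lt hu
      have h4 : 0 ≤ κ * sinh u - u := by
        rcases ht'.eq_or_lt with h | h
        · rw [ht0 h.symm, one_mul]
          exact sub_nonneg.2 (self_le_sinh_iff.2 hu0.le)
        · have h2 : 0 < sinh t := sinh_pos_iff.2 h
          have h1 := mul_sinh_le_mul_sinh h.le hu.le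
          refine nonneg_of_mul_nonneg_left (?_ : 0 ≤ (κ * sinh u - u) * sinh t) h2
          linear_combination h1 - sinh u * ht
      positivity
    exact hmono (Set.mem_Ici.2 le_rfl) (Set.mem_Ici.2 hst) hst

theorem log_cosh_sub_le {κ t : ℝ} (ht : κ * sinh t = t) (ht0 : t = 0 → κ = 1) (s : ℝ) :
    log (cosh t) - t * sinh t / cosh t - κ / cosh t ≤
      log (cosh s) - s * sinh s / cosh s - κ / cosh s := by
  have habs (r : ℝ) : |r| * sinh |r| = r * sinh r := by
    rcases abs_choice r with h | h <;> rw [h]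
    rw [sinh_neg, neg_mul_neg]
  have h := log_cosh_sub_le_of_nonneg (κ := κ) (s := |s|) (t := |t|)
    (by
      rcases abs_choice t with h | h <;> rw [h]
      · exact ht
      · rw [sinh_neg, mul_neg, ht])
    (fun h => ht0 (abs_eq_zero.1 h)) (abs_nonneg s) (abs_nonneg t)
  simpa only [cosh_abs, habs] using h

/-- The logarithmic Sobolev inequality of the two-state chain in hyperbolic coordinates. -/
theorem entropy_hyperbolic_le {κ t : ℝ} (ht : κ * sinh t = t) (ht0 : t = 0 → κ = 1) (s : ℝ) :
    (s - t) * sinh s - cosh s * (log (cosh s) - log (cosh t)) ≤ κ * (cosh (s - t) - 1) := by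
  have h := mul_le_mul_of_nonneg_left (log_cosh_sub_le ht ht0 s) (cosh_pos s).le
  have hs := (cosh_pos s).ne'
  have hct := (cosh_pos t).ne'
  have e1 : t * sinh t / cosh t + κ / cosh t = κ * cosh t := by
    field_simp
    linear_combination (-sinh t) * ht - κ * cosh_sq t
  have e2 : cosh s * (s * sinh s / cosh s) = s * sinh s := by field_simp
  have e3 : cosh s * (κ / cosh s) = κ := by field_simp
  rw [cosh_sub]
  linear_combination h + cosh s * e1 - e2 - e3 + sinh s * ht

/-- Optimality for `t = 0`: the factors of `S` and `M` are both `s ^ 2 / 2` to leading order, so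
dividing and letting `s → 0⁺` compares `S` with `M`. -/
theorem le_of_forall_entropy_hyperbolic_le {S M : ℝ} (hS : 0 ≤ S) (hM : 0 ≤ M)
    (h : ∀ s, S * (s * sinh s - cosh s * log (cosh s)) ≤ M * (cosh s - 1)) : S ≤ M := by
  have key : ∀ s : ℝ, 0 < s → S * (2 - cosh s) ≤ M * exp (s ^ 2 / 2) := by
    intro s hs
    have hc := cosh_pos s
    have h1 : s ≤ sinh s := self_le_sinh_iff.2 hs.le
    have h2 : log (cosh s) ≤ s ^ 2 / 2 :=
      (log_le_iff_le_exp hc).2 (cosh_le_exp_half_sq s)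
    -- With `v = s ^ 2 / 2`: `cosh s - 1 ≤ exp v - 1 ≤ v * exp v`.
    have h4 : cosh s - 1 ≤ s ^ 2 / 2 * exp (s ^ 2 / 2) := by
      have h5 := mul_le_mul_of_nonneg_right (one_sub_le_exp_neg (s ^ 2 / 2))
        (exp_pos (s ^ 2 / 2)).le
      rw [← exp_add, neg_add_cancel, exp_zero] at h5
      linear_combination h5 + cosh_le_exp_half_sq s
    have h7 : s * s - cosh s * (s ^ 2 / 2) ≤ s * sinh s - cosh s * log (cosh s) := by gcongr
    have h8 := (mul_le_mul_of_nonneg_left h7 hS).trans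
      ((h s).trans (mul_le_mul_of_nonneg_left h4 hM))
    have hs2 : 0 < s ^ 2 / 2 := by positivity
    refine le_of_mul_le_mul_right ?_ hs2
    linear_combination h8
  have hl : Filter.Tendsto (fun s : ℝ => S * (2 - cosh s)) (nhdsWithin 0 (Set.Ioi 0))
      (nhds S) := by
    have : Continuous fun s : ℝ => S * (2 - cosh s) := by fun_prop
    convert (this.tendsto 0).mono_left nhdsWithin_le_nhds using 2
    norm_num
  have hr : Filter.Tendsto (fun s : ℝ => M * exp (s ^ 2 / 2)) (nhdsWithin 0 (Set.Ioi 0))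
      (nhds M) := by
    have : Continuous fun s : ℝ => M * exp (s ^ 2 / 2) := by fun_prop
    convert (this.tendsto 0).mono_left nhdsWithin_le_nhds using 2
    norm_num
  exact le_of_tendsto_of_tendsto hl hr (eventually_nhdsWithin_of_forall key)

/-! ### The two-state chain -/

theorem entropy_fin_two {p x : Fin 2 → ℝ} (hp : ∀ i, 0 < p i) :
    entropy p x = p 0 * x 0 ^ 2 * log (x 0 ^ 2 / (p 0 * x 0 ^ 2 + p 1 * x 1 ^ 2)) +
      p 1 * x 1 ^ 2 * log (x 1 ^ 2 / (p 0 * x 0 ^ 2 + p 1 * x 1 ^ 2)) := by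
  have h : normW p 2 x ^ 2 = p 0 * x 0 ^ 2 + p 1 * x 1 ^ 2 := by
    have h0 := hp 0
    have h1 := hp 1
    simp only [normW, Fin.sum_univ_two, rpow_two, sq_abs]
    rw [← sqrt_eq_rpow, sq_sqrt (by positivity)]
  simp only [entropy, h, Fin.sum_univ_two, sq_abs]
  ring

theorem dirichlet_twoState {a b : ℝ} (x : Fin 2 → ℝ) :
    dirichlet (twoStateK a b) (twoStatePi a b) x x = a * b / (a + b) * (x 0 - x 1) ^ 2 := by
  simp [dirichlet, innerW, twoStateK, twoStatePi, Matrix.mulVec, dotProduct, Fin.sum_univ_two,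
    Matrix.diagonal]
  ring

theorem isMarkovChain_twoState {a b : ℝ} (ha : a ∈ Set.Ioc (0 : ℝ) 1)
    (hb : b ∈ Set.Ioc (0 : ℝ) 1) : IsMarkovChain (twoStateK a b) (twoStatePi a b) := by
  obtain ⟨ha0, ha1⟩ := ha
  obtain ⟨hb0, hb1⟩ := hb
  refine ⟨?_, ?_, ?_, ?_, ?_⟩
  · simp [twoStateK, Fin.forall_fin_two, ha0.le, hb0.le, ha1, hb1]
  · ext i
    fin_cases i <;> simp [twoStateK, Matrix.mulVec, dotProduct, Fin.sum_univ_two]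
  · ext i
    fin_cases i <;> simp [twoStateK, twoStatePi, Matrix.vecMul, dotProduct, Fin.sum_univ_two] <;>
      ring
  · simp only [Fin.forall_fin_two]
    constructor <;> simp [twoStatePi] <;> positivity
  · simp [twoStatePi, Fin.sum_univ_two]
    field_simp
    ring

theorem isIrreducible_twoStateK {a b : ℝ} (ha : a ∈ Set.Ioc (0 : ℝ) 1)
    (hb : b ∈ Set.Ioc (0 : ℝ) 1) : (twoStateK a b).IsIrreducible := by
  have hn := (isMarkovChain_twoState ha hb).nonneg
  have := ha.1
  have := hb.1
  rw [Matrix.isIrreducible_iff_exists_pow_pos hn]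
  simp only [Fin.forall_fin_two]
  -- The diagonal of `K` vanishes where `a` or `b` is `1`; the diagonal of `K ^ 2` is at least `a *
  -- b`.
  refine ⟨⟨⟨2, two_pos, ?_⟩, ⟨1, one_pos, ?_⟩⟩, ⟨⟨1, one_pos, ?_⟩, ⟨2, two_pos, ?_⟩⟩⟩ <;>
    simp [twoStateK, pow_two, Matrix.mul_apply, Fin.sum_univ_two] <;>
    first
    | assumption
    | nlinarith [mul_pos ha.1 hb.1, mul_self_nonneg (1 - a), mul_self_nonneg (1 - b)]

/-- The coordinates `a = M * exp (-t)`, `b = M * exp t`, `x = (r * exp u, r * exp (-u))` turn the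
entropy and the Dirichlet form into hyperbolic functions. -/
theorem entropy_twoState_exp {M r t u : ℝ} (hM : 0 < M) (hr : 0 < r) :
    entropy (twoStatePi (M * exp (-t)) (M * exp t)) ![r * exp u, r * exp (-u)] =
      r ^ 2 / cosh t * ((t + 2 * u - t) * sinh (t + 2 * u) -
        cosh (t + 2 * u) * (log (cosh (t + 2 * u)) - log (cosh t))) := by
  have hs : M * exp (-t) + M * exp t = 2 * M * cosh t := by rw [cosh_eq]; ring
  have hct := cosh_pos t
  have hcs := cosh_pos (t + 2 * u)
  have e1 : exp t * exp u ^ 2 = exp (t + 2 * u) := by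
    rw [← exp_nat_mul, ← exp_add]; norm_num
  have e2 : exp (-t) * exp (-u) ^ 2 = exp (-(t + 2 * u)) := by
    rw [← exp_nat_mul, ← exp_add]; congr 1; push_cast; ring
  have p0 : twoStatePi (M * exp (-t)) (M * exp t) 0 = exp t / (2 * cosh t) := by
    simp [twoStatePi, hs]; field_simp
  have p1 : twoStatePi (M * exp (-t)) (M * exp t) 1 = exp (-t) / (2 * cosh t) := by
    simp [twoStatePi, hs]; field_simp
  rw [entropy_fin_two (by
    rw [Fin.forall_fin_two, p0, p1]; constructor <;> positivity), p0, p1]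
  simp only [Matrix.cons_val_zero, Matrix.cons_val_one]
  have hN : exp t / (2 * cosh t) * (r * exp u) ^ 2 + exp (-t) / (2 * cosh t) * (r * exp (-u)) ^ 2
      = r ^ 2 * cosh (t + 2 * u) / cosh t := by
    rw [cosh_eq (t + 2 * u), ← e1, ← e2]; field_simp
  have hlog (v : ℝ) : log ((r * exp v) ^ 2 / (r ^ 2 * cosh (t + 2 * u) / cosh t)) =
      2 * v - (log (cosh (t + 2 * u)) - log (cosh t)) := by
    have : (r * exp v) ^ 2 / (r ^ 2 * cosh (t + 2 * u) / cosh t) =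
      exp v ^ 2 / (cosh (t + 2 * u) / cosh t) := by field_simp
    rw [this, log_div (by positivity) (by positivity), log_div hcs.ne' hct.ne', log_pow, log_exp]
    norm_num
  rw [hN, hlog, hlog]
  have c0 : exp t / (2 * cosh t) * (r * exp u) ^ 2 =
      r ^ 2 / cosh t * ((cosh (t + 2 * u) + sinh (t + 2 * u)) / 2) := by
    rw [cosh_add_sinh, ← e1]; field_simp
  have c1 : exp (-t) / (2 * cosh t) * (r * exp (-u)) ^ 2 =
      r ^ 2 / cosh t * ((cosh (t + 2 * u) - sinh (t + 2 * u)) / 2) := by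
    rw [cosh_sub_sinh, ← e2]; field_simp
  rw [c0, c1]
  ring

theorem dirichlet_twoState_exp {M r t u : ℝ} (hM : 0 < M) :
    dirichlet (twoStateK (M * exp (-t)) (M * exp t)) (twoStatePi (M * exp (-t)) (M * exp t))
        ![r * exp u, r * exp (-u)] ![r * exp u, r * exp (-u)] =
      r ^ 2 / cosh t * (M * (cosh (t + 2 * u - t) - 1)) := by
  have hs : M * exp (-t) + M * exp t = 2 * M * cosh t := by rw [cosh_eq]; ring
  have ht : exp (-t) * exp t = 1 := by rw [← exp_add]; simp
  have hu : exp u * exp (-u) = 1 := by rw [← exp_add]; simp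
  have hct := cosh_pos t
  have hc : (exp u - exp (-u)) ^ 2 = 2 * (cosh (t + 2 * u - t) - 1) := by
    rw [add_sub_cancel_left, cosh_eq, ← mul_neg, two_mul u, two_mul (-u), exp_add, exp_add]
    linear_combination (-2) * hu
  rw [dirichlet_twoState, hs]
  simp only [Matrix.cons_val_zero, Matrix.cons_val_one]
  have hm : M * exp (-t) * (M * exp t) = M ^ 2 := by linear_combination M ^ 2 * ht
  rw [hm, ← mul_sub, mul_pow, hc]
  field_simp

theorem mem_logSobolevSet_twoState_iff {M t S : ℝ} (hM : 0 < M) :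
    S ∈ logSobolevSet (twoStateK (M * exp (-t)) (M * exp t))
        (twoStatePi (M * exp (-t)) (M * exp t)) ↔
      0 ≤ S ∧ ∀ s, S * ((s - t) * sinh s - cosh s * (log (cosh s) - log (cosh t))) ≤
        M * (cosh (s - t) - 1) := by
  have hct := cosh_pos t
  refine and_congr_right fun _ => ⟨fun h s => ?_, fun h x hx => ?_⟩
  · have h1 := h ![1 * exp ((s - t) / 2), 1 * exp (-((s - t) / 2))]
      (by simp [Fin.forall_fin_two, exp_pos])
    rw [entropy_twoState_exp hM one_pos, dirichlet_twoState_exp hM,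
      show t + 2 * ((s - t) / 2) = s by ring, mul_left_comm] at h1
    exact le_of_mul_le_mul_left h1 (by positivity)
  · obtain ⟨r, u, hr, rfl⟩ : ∃ r u : ℝ, 0 < r ∧ x = ![r * exp u, r * exp (-u)] := by
      -- `r` is the geometric mean of the entries.
      refine ⟨exp ((log (x 0) + log (x 1)) / 2), (log (x 0) - log (x 1)) / 2, exp_pos _, ?_⟩
      ext i
      fin_cases i
      · simp only [← exp_add]
        ring_nf
        simp [exp_log (hx 0)]
      · simp only [← exp_add]
        ring_nf
        simp [exp_log (hx 1)]
    rw [entropy_twoState_exp hM hr, dirichlet_twoState_exp hM, mul_left_comm]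
    exact mul_le_mul_of_nonneg_left (h _) (by positivity)

/-- At `t = 0` the equation `κ * sinh t = t` leaves `κ` free, so `ht0` fixes it at the limit of `t /
sinh t`. -/
theorem isGreatest_logSobolevSet_twoState {M κ t : ℝ} (hM : 0 < M) (hκ : 0 < κ)
    (ht : κ * sinh t = t) (ht0 : t = 0 → κ = 1) :
    IsGreatest (logSobolevSet (twoStateK (M * exp (-t)) (M * exp t))
      (twoStatePi (M * exp (-t)) (M * exp t))) (M / κ) := by
  constructor
  · rw [mem_logSobolevSet_twoState_iff hM]
    refine ⟨by positivity, fun s => ?_⟩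
    calc _ ≤ M / κ * (κ * (cosh (s - t) - 1)) :=
          mul_le_mul_of_nonneg_left (entropy_hyperbolic_le ht ht0 s) (by positivity)
      _ = _ := by field_simp
  · intro S hS
    rw [mem_logSobolevSet_twoState_iff hM] at hS
    obtain ⟨hS0, hS⟩ := hS
    by_cases h : t = 0
    · rw [ht0 h, div_one]
      subst h
      exact le_of_forall_entropy_hyperbolic_le hS0 hM.le fun s => by simpa using hS s
    -- The equality case: the weights `π i * x i ^ 2` are proportional to `π` with its two entries
    -- swapped.
    · have h1 := hS (-t)
      have h2 : 0 < sinh t ^ 2 := sq_pos_of_ne_zero (sinh_ne_zero.2 h)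
      rw [cosh_neg, sinh_neg, sub_self, mul_zero, sub_zero, ← neg_add', cosh_neg, ← two_mul,
        cosh_two_mul, cosh_sq] at h1
      rw [le_div_iff₀ hκ]
      refine le_of_mul_le_mul_right ?_ (mul_pos two_pos h2)
      linear_combination h1 + 2 * S * sinh t * ht

end MarkovLS

open Real MarkovLS in
theorem mainTheorem11 (a b : ℝ) (ha : a ∈ Set.Ioc (0 : ℝ) 1) (hb : b ∈ Set.Ioc (0 : ℝ) 1) :
    MarkovLS.IsMarkovChain (MarkovLS.twoStateK a b) (MarkovLS.twoStatePi a b) ∧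
    (MarkovLS.twoStateK a b).IsIrreducible ∧
    IsLUB (MarkovLS.logSobolevSet (MarkovLS.twoStateK a b) (MarkovLS.twoStatePi a b))
      (MarkovLS.logSobolevConst (MarkovLS.twoStateK a b) (MarkovLS.twoStatePi a b)) ∧
    Real.sqrt (a * b) ≤
      MarkovLS.logSobolevConst (MarkovLS.twoStateK a b) (MarkovLS.twoStatePi a b) ∧
    MarkovLS.logSobolevConst (MarkovLS.twoStateK a b) (MarkovLS.twoStatePi a b) =
      if a ≠ b then (a - b) / (Real.log a - Real.log b) else a := by
  have ha0 := ha.1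
  have hb0 := hb.1
  refine ⟨isMarkovChain_twoState ha hb, isIrreducible_twoStateK ha hb, ?_⟩
  obtain ⟨M, t, κ, hM, hκ, hκ1, ht, ht0, rfl, rfl⟩ : ∃ M t κ : ℝ, 0 < M ∧ 0 < κ ∧ κ ≤ 1 ∧
      κ * sinh t = t ∧ (t = 0 → κ = 1) ∧ a = M * exp (-t) ∧ b = M * exp t := by
    set t := (log b - log a) / 2 with ht
    have haM : a = exp ((log a + log b) / 2) * exp (-t) := by
      rw [← exp_add, ht]; ring_nf; rw [exp_log ha0]
    have hbM : b = exp ((log a + log b) / 2) * exp t := by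
      rw [← exp_add, ht]; ring_nf; rw [exp_log hb0]
    by_cases h : t = 0
    · exact ⟨_, t, 1, exp_pos _, one_pos, le_rfl, by simp [h], fun _ => rfl, haM, hbM⟩
    · have h1 : sinh t ≠ 0 := sinh_ne_zero.2 h
      have h2 : 0 < t / sinh t ∧ t / sinh t ≤ 1 := by
        rcases lt_or_gt_of_ne h with h | h
        · have := sinh_neg_iff.2 h
          exact ⟨div_pos_of_neg_of_neg h this, (div_le_one_of_neg this).2
            (sinh_le_self_iff.2 h.le)⟩
        · have := sinh_pos_iff.2 h
          exact ⟨div_pos h this, (div_le_one this).2 (self_le_sinh_iff.2 h.le)⟩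
      exact ⟨_, t, t / sinh t, exp_pos _, h2.1, h2.2, div_mul_cancel₀ _ h1,
        fun h' => absurd h' h, haM, hbM⟩
  have hG := isGreatest_logSobolevSet_twoState hM hκ ht ht0
  have hσ : logSobolevConst (twoStateK (M * exp (-t)) (M * exp t))
      (twoStatePi (M * exp (-t)) (M * exp t)) = M / κ := hG.csSup_eq
  rw [hσ]
  refine ⟨hG.isLUB, ?_, ?_⟩
  · have : M * exp (-t) * (M * exp t) = M ^ 2 := by
      rw [mul_mul_mul_comm, ← exp_add, neg_add_cancel, exp_zero, mul_one, sq]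
    rw [this, sqrt_sq hM.le]
    exact le_div_self hM.le hκ hκ1
  · by_cases h : t = 0
    · simp [h, ht0 h]
    · have hne : M * exp (-t) ≠ M * exp t := fun h' => h (by
        have := exp_injective (mul_left_cancel₀ hM.ne' h')
        linarith)
      rw [if_pos hne, log_mul hM.ne' (exp_ne_zero _), log_mul hM.ne' (exp_ne_zero _), log_exp,
        log_exp]
      have e1 : M * exp (-t) - M * exp t = -(2 * M * sinh t) := by rw [sinh_eq]; ring
      have e2 : log M + -t - (log M + t) = -(2 * t) := by ring
      rw [e1, e2, neg_div_neg_eq, div_eq_div_iff hκ.ne' (by simpa using h)]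
      linear_combination (-2 * M) * ht
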